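/- Let $(\mathcal T,\oplus,\odot)$ be a commutative semiring with zero $\mathbb 0$ and unit $\mathbb 1$, endowed with a symmetry $\ominus$, i.e. a map $a\mapsto\ominus a$ with $\ominus(a\oplus b)=(\ominus a)\oplus(\ominus b)$, $\ominus\mathbb 0=\mathbb 0$, $\ominus(ab)=a(\ominus b)=(\ominus a)b$ and $\ominus(\ominus a)=a$. Put $a^\circ=a\oplus(\ominus a)$, and write $a\preccurlyeq b$ if $b=a\oplus c$ for some $c\in\mathcal T$, and $a\succeq^\circ b$ if $a=b\oplus c^\circ$ for some $c\in\mathcal T$. Let $\mathcal T^*$ be the set of invertible elements of $\mathcal T$. Assume that $\preccurlyeq$ is a (partial) order on $\mathcal T$, and that there is a surjective semiring morphism (modulus) $a\mapsto|a|$ from $\mathcal T$ onto a totally ordered idempotent semifield $\mathcal M$ (ordered by its natural order $\preceq$, defined as $\preccurlyeq$ above), such that for all $a,b\in\mathcal T$: * if $|a|\prec|b|$, then $a\oplus b=b$; * if $a\preccurlyeq b$, $|a|=|b|$ and $b\in\mathcal T^*\cup\{\mathbb 0\}$, then $a=b$; * $a^\circ\oplus a^\circ=a^\circ$. Write $a\succeq_{\mathrm{mod}}b$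 if $a\succeq^\circ b$ and $|a|=|b|$. For a bijection $\sigma:I\to J$ between finite totally ordered sets, let $\operatorname{sign}(\sigma)=(\ominus\mathbb 1)^{|\operatorname{inv}(\sigma)|}$, where $\operatorname{inv}(\sigma)=\{(i,j)\in I^2: i<j,\ \sigma(i)>\sigma(j)\}$. Let $n\ge 1$ and $A=(a_{i,j})\in\mathcal T^{n\times n}$. Put $\det(A)=\bigoplus_{\sigma}\operatorname{sign}(\sigma)\bigodot_{i}a_{i,\sigma(i)}$, the sum being over all permutations $\sigma$ of $[n]=\{1,\dots,n\}$, and let $\operatorname{adj}(A)_{i,j}=(\ominus\mathbb 1)^{i+j}\det(A_{(j,i)})$, where $A_{(j,i)}$ is $A$ with row $j$ and column $i$ deleted. For $0\le k\le n$, let $A^{\wedge k}$ be the $k$-th compound matrix, indexed by the $k$-element subsets of $[n]$ in lexicographic order, with entries $A^{\wedge k}_{I,J}=\bigoplus_{\sigma:I\to J\text{ bijection}}\operatorname{sign}(\sigma)\bigodot_{i\in I}a_{i,\sigma(i)}$. Call $A$ nonsingular if $\det(A)\in\mathcal T^*$, and definite if $\det(A)=\mathbb 1$ and $a_{i,i}=\mathbb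 1$ for all $i$. For $A$ nonsingular, let $A^\nabla=\det(A)^{-1}\operatorname{adj}(A)$. 1. If $A$ is definite, then $(A^\nabla)_{i,i}=(AA^\nabla)_{i,i}=\mathbb 1$ for all $i\in[n]$, and $$\det(AA^\nabla)\succeq_{\mathrm{mod}}\det(A^\nabla)=\det(A^{\wedge n-1})\succeq_{\mathrm{mod}}\mathbb 1 .$$ 2. If $A$ is nonsingular, then $$\det(\operatorname{adj}(A))\succeq_{\mathrm{mod}}\det(A)^{n-1},\qquad \det(A\operatorname{adj}(A))\succeq_{\mathrm{mod}}\det(A)^{n},\qquad \det(A^\nabla)\succeq_{\mathrm{mod}}\det(A)^{-1}.$$ -/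

import Mathlib

namespace ExtTrop

/-- A commutative semiring with a symmetry `a ↦ -a` (written `⊖ a` in the literature): an additive
involution compatible with multiplication. In general `a + -a` is not zero. -/
class SymmetrySemiring (S : Type*) extends CommSemiring S, Neg S where
  symm_add : ∀ a b : S, -(a + b) = -a + -b
  symm_zero : -(0 : S) = 0
  symm_mul_right : ∀ a b : S, -(a * b) = a * -b
  symm_mul_left : ∀ a b : S, -(a * b) = -a * b
  symm_symm : ∀ a : S, - -a = a

/-- The natural preorder `a ≼ b` of a semiring: `b = a ⊕ c` for some `c`. -/
def NatLE {S : Type*} [Semiring S] (a b : S) : Prop := ∃ c : S, b = a + c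

/-- A semiring is naturally ordered when its natural preorder is an order. -/
def NaturallyOrdered (S : Type*) [Semiring S] : Prop :=
  ∀ a b : S, NatLE a b → NatLE b a → a = b

/-- An idempotent semiring whose natural order is total. -/
structure IsTotallyOrderedIdempotent (M : Type*) [Semiring M] : Prop where
  add_idem : ∀ a : M, a + a = a
  total : ∀ a b : M, NatLE a b ∨ NatLE b a

section Symmetry

variable {S : Type*} [SymmetrySemiring S]

/-- `a° = a ⊖ a`. -/
def circ (a : S) : S := a + -a

/-- `a ⪰° b`: `a = b ⊕ c` for some `c` in the ideal `S° = {x° | x ∈ S}`. -/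
def CircGE (a b : S) : Prop := ∃ c ∈ Set.range (circ : S → S), a = b + c

/-- `a ⪰° b` and `|a| = |b|`, where `|·|` is the modulus `μ`. -/
def ModGE {M : Type*} [Semiring M] (μ : S →+* M) (a b : S) : Prop :=
  CircGE a b ∧ μ a = μ b

/-- The standing assumptions on an extended tropical semiring `S` with modulus `μ : S → M`:
`M` is a totally ordered idempotent semifield, `μ` is a surjective semiring morphism, `S` is
naturally ordered, and the three properties `domination`, `rigidity`, `circ_idem` hold. -/
structure IsExtendedTropical {M : Type*} [Semifield M] (μ : S →+* M) : Prop where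
  totallyOrdered : IsTotallyOrderedIdempotent M
  surjective : Function.Surjective μ
  naturallyOrdered : NaturallyOrdered S
  /-- `|a| ≺ |b|` implies `a ⊕ b = b`. -/
  domination : ∀ a b : S, NatLE (μ a) (μ b) → μ a ≠ μ b → a + b = b
  /-- If `a ≼ b`, `|a| = |b|` and `b` is invertible or zero, then `a = b`. -/
  rigidity : ∀ a b : S, NatLE a b → μ a = μ b → (IsUnit b ∨ b = 0) → a = b
  circ_idem : ∀ a : S, circ a + circ a = circ a

section Determinant

variable {ι κ : Type*} [LinearOrder ι] [Fintype ι] [LinearOrder κ] [Fintype κ]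

/-- The inversions of a bijection between two finite totally ordered sets. -/
def inversions (σ : ι ≃ κ) : Finset (ι × ι) :=
  Finset.univ.filter fun p => p.1 < p.2 ∧ σ p.1 > σ p.2

variable (S) in
/-- The sign of a bijection, an element of `S`: `⊖ 1` to the number of inversions. -/
def sign (σ : ι ≃ κ) : S := (-1 : S) ^ (inversions σ).card

/-- The determinant of a square matrix over `S`. Rows and columns may be indexed by two different
totally ordered sets of the same cardinality `m`, as for minors; the matrix is then identified with
an `m × m` matrix through the orders. -/
def det (A : Matrix ι κ S) : S := ∑ σ : ι ≃ κ, sign S σ * ∏ i, A i (σ i)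

end Determinant

/-- The `k`-element subsets of `α`. -/
def KSubset (α : Type*) (k : ℕ) : Type _ := {I : Finset α // I.card = k}

instance (α : Type*) [Fintype α] (k : ℕ) : Fintype (KSubset α k) :=
  inferInstanceAs (Fintype {I : Finset α // I.card = k})

/-- The lexicographic order: compare the increasing lists of elements lexicographically. -/
instance (α : Type*) [LinearOrder α] (k : ℕ) : LinearOrder (KSubset α k) :=
  LinearOrder.lift' (fun I => I.1.sort (· ≤ ·)) fun I J h => Subtype.ext (by
    have h' := congrArg List.toFinset h
    simpa using h')

/-- The `k`-th compound matrix: the matrix of all `k × k` minors. -/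
def compound {α : Type*} [LinearOrder α] (k : ℕ) (A : Matrix α α S) :
    Matrix (KSubset α k) (KSubset α k) S := fun I J =>
  det (A.submatrix (fun i : {x // x ∈ I.1} => i.1) (fun j : {x // x ∈ J.1} => j.1))

variable {n : ℕ}

/-- The `(r, c)`-minor: the determinant of `A` with row `r` and column `c` deleted. -/
def minor (A : Matrix (Fin n) (Fin n) S) (r c : Fin n) : S :=
  det (A.submatrix (fun i : {x // x ≠ r} => i.1) (fun j : {x // x ≠ c} => j.1))

/-- The adjoint matrix. Counting indices from `0` instead of `1` does not change the signs. -/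
def adj (A : Matrix (Fin n) (Fin n) S) : Matrix (Fin n) (Fin n) S := fun i j =>
  (-1 : S) ^ ((i : ℕ) + (j : ℕ)) * minor A j i

/-- A matrix is nonsingular when its determinant is invertible in `S`. -/
def Nonsingular (A : Matrix (Fin n) (Fin n) S) : Prop := IsUnit (det A)

/-- A matrix is definite when its determinant and all its diagonal entries are `1`. -/
def IsDefinite (A : Matrix (Fin n) (Fin n) S) : Prop := det A = 1 ∧ ∀ i, A i i = 1

/-- The quasi-inverse `A^∇ = adj(A) det(A)⁻¹` of a nonsingular matrix (`Ring.inverse x` is the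
inverse of `x` when `x` is invertible). It is only used for nonsingular matrices. -/
noncomputable def quasiInverse (A : Matrix (Fin n) (Fin n) S) : Matrix (Fin n) (Fin n) S :=
  fun i j => adj A i j * Ring.inverse (det A)

end Symmetry

end ExtTrop

open ExtTrop

/-!
The determinant identities `det (adj A) = det A ^ (n - 1)` and `det (A * adj A) = det A ^ n` are
transferred from commutative rings to semirings with symmetry, where nothing cancels.

Matrices of variables are expanded over `Symmetrized ℕ[x]`, the formal differences of polynomials
with natural coefficients. If two such differences `P` and `Q` agree in `ℤ[x]`, then cancelling
coefficientwise minima gives `P = r + c°` and `Q = r + c'°` with the same `r`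
(`exists_common_part`). This is used in two ways.

* If `Q` is a signed sum of distinct monomials, then `c' = 0` and `P = Q + c°`
  (`exists_eq_add_circ`). This gives the Cauchy–Binet relation `det (A * B) ⪰° det A * det B`
  (`circGE_det_mul`) and, by counting terms, the Laplace expansion (`mul_adj_diag`).
* Take `Q = det X ^ k`, which does have cancellations. If `det A` is invertible, then by rigidity it
  is equal to one term of its expansion, of maximal modulus. Restricting `A` to the graph of the
  corresponding permutation makes `Q` a single monomial, so `c'` vanishes there, and
  `det A ^ k ≼ r(A) ≼ det A ^ k`. As the natural preorder is an order, `r(A) = det A ^ k`, hence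
  `P(A) ⪰° det A ^ k` (`circGE_det_pow`).

For the moduli it remains to bound `|det (adj A)|` and `|det (A * adj A)|` from above. All monomials
of these polynomials have the same degree `k` in each row and each column of `X`, so that by Hall's
theorem each is a product of `k` permutation monomials, of modulus at most `|det A| ^ k`
(`prod_pow_natLE_permanent`).

The compound matrix of order `n - 1` is the adjoint up to transposition, signs which cancel in the
determinant, and the reindexing by complements of points, which reverses the lexicographic order
(`det_adj_eq_det_compound`).
-/

namespace ExtTrop

/-! ### Semirings with symmetry -/

section Basic

variable {S : Type*} [SymmetrySemiring S]

theorem symm_eq_mul (a : S) : -a = -1 * a := by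
  rw [← SymmetrySemiring.symm_mul_left, one_mul]

theorem neg_one_mul_neg_one : (-1 : S) * -1 = 1 := by
  rw [← symm_eq_mul, SymmetrySemiring.symm_symm]

theorem neg_one_pow_add_self (k : ℕ) : (-1 : S) ^ (k + k) = 1 := by
  rw [pow_add, ← mul_pow, neg_one_mul_neg_one, one_pow]

theorem mul_circ (a b : S) : a * circ b = circ (a * b) := by
  simp only [circ, SymmetrySemiring.symm_mul_right, mul_add]

theorem circ_zero : circ (0 : S) = 0 := by
  simp [circ, SymmetrySemiring.symm_zero]

theorem circGE_iff {a b : S} : CircGE a b ↔ ∃ c : S, a = b + circ c := by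
  simp [CircGE]

theorem CircGE.mul_left {a b : S} (h : CircGE a b) (c : S) : CircGE (c * a) (c * b) := by
  obtain ⟨d, rfl⟩ := circGE_iff.1 h
  exact circGE_iff.2 ⟨c * d, by rw [mul_add, mul_circ]⟩

end Basic

section NatLE

variable {S : Type*} [CommSemiring S]

theorem NatLE.refl (a : S) : NatLE a a := ⟨0, (add_zero a).symm⟩

theorem NatLE.mul {a b c d : S} (h : NatLE a b) (h' : NatLE c d) : NatLE (a * c) (b * d) := by
  obtain ⟨x, rfl⟩ := h
  obtain ⟨y, rfl⟩ := h'
  exact ⟨a * y + x * c + x * y, by ring⟩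

theorem NatLE.add {a b c d : S} (h : NatLE a b) (h' : NatLE c d) : NatLE (a + c) (b + d) := by
  obtain ⟨x, rfl⟩ := h
  obtain ⟨y, rfl⟩ := h'
  exact ⟨x + y, add_add_add_comm _ _ _ _⟩

theorem NatLE.trans {a b c : S} (h : NatLE a b) (h' : NatLE b c) : NatLE a c := by
  obtain ⟨x, rfl⟩ := h
  obtain ⟨y, rfl⟩ := h'
  exact ⟨x + y, add_assoc _ _ _⟩

theorem NatLE.map {S' : Type*} [CommSemiring S'] (f : S →+* S') {a b : S} (h : NatLE a b) :
    NatLE (f a) (f b) := by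
  obtain ⟨x, rfl⟩ := h
  exact ⟨f x, map_add _ _ _⟩

theorem natLE_sum {ι : Type*} [Fintype ι] (f : ι → S) (i : ι) : NatLE (f i) (∑ j, f j) := by
  classical
  exact ⟨_, (Finset.add_sum_erase Finset.univ f (Finset.mem_univ i)).symm⟩

end NatLE

/-- A commutative ring, with its opposite as symmetry. -/
abbrev ringSymmetry (R : Type*) [h : CommRing R] : SymmetrySemiring R :=
  { h with
    symm_add := fun a b => neg_add a b
    symm_zero := neg_zero
    symm_mul_right := fun a b => (mul_neg a b).symm
    symm_mul_left := fun a b => (neg_mul a b).symm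
    symm_symm := neg_neg }

/-- A commutative semiring with the identity as symmetry; the determinant is then the permanent. -/
abbrev trivialSymmetry (R : Type*) [h : CommSemiring R] : SymmetrySemiring R :=
  { h with
    neg := fun a => a
    symm_add := fun _ _ => rfl
    symm_zero := rfl
    symm_mul_right := fun _ _ => rfl
    symm_mul_left := fun _ _ => rfl
    symm_symm := fun _ => rfl }

/-! ### Determinants: naturality and reindexing -/

section Natural

variable {S S' : Type*} [SymmetrySemiring S] [SymmetrySemiring S']

/-- Determinants are natural for morphisms of semirings which commute with the symmetries. -/
theorem map_det {ι κ : Type*} [LinearOrder ι] [Fintype ι] [LinearOrder κ] [Fintype κ]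
    (f : S →+* S') (hf : ∀ a, f (-a) = -f a) (A : Matrix ι κ S) :
    f (det A) = det (A.map f) := by
  simp [det, sign, map_sum, map_prod, hf]

theorem map_adj {n : ℕ} (f : S →+* S') (hf : ∀ a, f (-a) = -f a) (A : Matrix (Fin n) (Fin n) S) :
    (adj A).map f = adj (A.map f) := by
  ext i j
  simp only [adj, minor, Matrix.map_apply, map_mul, map_pow, hf, map_one, map_det f hf]
  rfl

end Natural

section Reindex

variable {S : Type*} [SymmetrySemiring S]
variable {ι κ ι' κ' : Type*} [LinearOrder ι] [Fintype ι] [LinearOrder κ] [Fintype κ]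
  [LinearOrder ι'] [Fintype ι'] [LinearOrder κ'] [Fintype κ']

/-- Reindexing rows and columns preserves the determinant as soon as it preserves the numbers of
inversions. -/
theorem det_submatrix_of_card (e₁ : ι ≃ ι') (e₂ : κ ≃ κ') (A : Matrix ι' κ' S)
    (h : ∀ σ : ι ≃ κ, (inversions (Equiv.equivCongr e₁ e₂ σ)).card = (inversions σ).card) :
    det (A.submatrix e₁ e₂) = det A := by
  unfold det
  refine Fintype.sum_equiv (Equiv.equivCongr e₁ e₂) _ _ fun σ => ?_
  rw [sign, sign, h]
  congr 1
  exact Fintype.prod_equiv e₁ _ _ fun i => by simp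

theorem det_submatrix_orderIso (e₁ : ι ≃o ι') (e₂ : κ ≃o κ') (A : Matrix ι' κ' S) :
    det (A.submatrix e₁ e₂) = det A := by
  refine det_submatrix_of_card e₁.toEquiv e₂.toEquiv A fun σ => ?_
  refine (Finset.card_equiv (e₁.toEquiv.prodCongr e₁.toEquiv) fun p => ?_).symm
  simp [inversions]

/-- Reversing the order of both rows and columns maps the inversions of each permutation bijectively
to those of the conjugate permutation. -/
theorem det_submatrix_antitone (e : ι ≃ ι') (he : StrictAnti e) (A : Matrix ι' ι' S) :
    det (A.submatrix e e) = det A := by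
  refine det_submatrix_of_card e e A fun σ => ?_
  refine (Finset.card_equiv ((e.prodCongr e).trans (Equiv.prodComm _ _)) fun p => ?_).symm
  simp [inversions, he.lt_iff_gt]

theorem card_inversions_symm (σ : ι ≃ κ) : (inversions σ.symm).card = (inversions σ).card := by
  refine Finset.card_equiv ((σ.symm.prodCongr σ.symm).trans (Equiv.prodComm _ _)) fun p => ?_
  simp [inversions, and_comm]

theorem det_transpose (A : Matrix ι κ S) : det A.transpose = det A := by
  unfold det
  refine Fintype.sum_equiv ⟨Equiv.symm, Equiv.symm, fun _ => rfl, fun _ => rfl⟩ _ _ fun σ => ?_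
  rw [sign, sign]
  simp only [Equiv.coe_fn_mk, card_inversions_symm]
  congr 1
  exact Fintype.prod_equiv σ _ _ fun i => by simp

theorem det_const_mul (c : S) (A : Matrix ι κ S) :
    det (fun i j => c * A i j) = c ^ Fintype.card ι * det A := by
  simp only [det, Finset.prod_mul_distrib, Finset.prod_const, Finset.card_univ, Finset.mul_sum]
  exact Finset.sum_congr rfl fun σ _ => by ring

/-- The signs of a permutation term are `(-1) ^ (i + σ i)`, and their product is `1`. -/
theorem det_sign_conj {n : ℕ} (A : Matrix (Fin n) (Fin n) S) :
    det (fun i j : Fin n => (-1 : S) ^ ((i : ℕ) + (j : ℕ)) * A i j) = det A := by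
  unfold det
  refine Finset.sum_congr rfl fun σ _ => ?_
  congr 1
  rw [Finset.prod_mul_distrib]
  simp only [pow_add, Finset.prod_mul_distrib]
  rw [Equiv.prod_comp σ (fun i : Fin n => (-1 : S) ^ (i : ℕ)), ← Finset.prod_mul_distrib]
  simp [← pow_add, neg_one_pow_add_self]

end Reindex

/-! ### Comparison with the determinant of a commutative ring -/

section Ring

variable {R : Type*} [CommRing R] {n : ℕ}

theorem neg_one_pow_card_inversions (σ : Equiv.Perm (Fin n)) :
    (-1 : ℤˣ) ^ (inversions σ).card = Equiv.Perm.sign σ := by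
  rw [Equiv.Perm.sign_eq_prod_prod_Ioi]
  have h : ∀ i : Fin n, ∀ j ∈ Finset.Ioi i, (if σ i < σ j then (1 : ℤˣ) else -1)
      = if σ i > σ j then -1 else 1 := by
    intro i j hj
    have hne : σ i ≠ σ j := fun h => (Finset.mem_Ioi.1 hj).ne (σ.injective h)
    rcases lt_or_gt_of_ne hne with h | h
    · simp [h, h.le]
    · simp [h, h.le]
  rw [Finset.prod_congr rfl fun i _ => Finset.prod_congr rfl (h i), inversions,
    ← Finset.prod_const, Finset.prod_filter, Fintype.prod_prod_type]
  refine Finset.prod_congr rfl fun i _ => ?_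
  have : Finset.Ioi i = Finset.univ.filter (i < ·) := by ext; simp
  rw [this, Finset.prod_filter]
  refine Finset.prod_congr rfl fun j _ => ?_
  by_cases h1 : i < j <;> simp [h1]

/-- Over a commutative ring, counting inversions gives the usual determinant. -/
theorem det_ringSymmetry (A : Matrix (Fin n) (Fin n) R) :
    letI := ringSymmetry R
    det A = A.det := by
  rw [← Matrix.det_transpose, Matrix.det_apply']
  refine Finset.sum_congr rfl fun σ _ => ?_
  rw [← neg_one_pow_card_inversions]
  simp [sign]

theorem minor_eq_det_submatrix {S : Type*} [SymmetrySemiring S]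
    (A : Matrix (Fin (n + 1)) (Fin (n + 1)) S) (r c : Fin (n + 1)) :
    minor A r c = det (A.submatrix r.succAbove c.succAbove) := by
  rw [minor, ← det_submatrix_orderIso (finSuccAboveOrderIso r) (finSuccAboveOrderIso c)]
  rfl

theorem adj_ringSymmetry (A : Matrix (Fin n) (Fin n) R) :
    letI := ringSymmetry R
    adj A = A.adjugate := by
  cases n with
  | zero => exact Subsingleton.elim _ _
  | succ n =>
    ext i j
    rw [Matrix.adjugate_fin_succ_eq_det_submatrix, ← det_ringSymmetry]
    let := ringSymmetry R
    rw [adj, minor_eq_det_submatrix, add_comm]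

end Ring

/-! ### The formal symmetrization of a semiring -/

/-- Formal differences `pos ⊖ neg` over a semiring `N`. Nothing cancels: `(a, b)` and
`(a + c, b + c)` are different elements. Over `N = ℕ[x]` this is the free commutative semiring with
symmetry, in which determinants of generic matrices are expanded. -/
@[ext]
structure Symmetrized (N : Type*) where
  pos : N
  neg : N

namespace Symmetrized

variable {N : Type*} [CommSemiring N]

instance : Zero (Symmetrized N) := ⟨⟨0, 0⟩⟩

instance : Add (Symmetrized N) := ⟨fun x y => ⟨x.pos + y.pos, x.neg + y.neg⟩⟩

instance : CommSemiring (Symmetrized N) where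
  mul x y := ⟨x.pos * y.pos + x.neg * y.neg, x.pos * y.neg + x.neg * y.pos⟩
  one := ⟨1, 0⟩
  add_assoc _ _ _ := Symmetrized.ext (add_assoc _ _ _) (add_assoc _ _ _)
  add_comm _ _ := Symmetrized.ext (add_comm _ _) (add_comm _ _)
  zero_add _ := Symmetrized.ext (zero_add _) (zero_add _)
  add_zero _ := Symmetrized.ext (add_zero _) (add_zero _)
  nsmul := nsmulRec
  mul_assoc x y z := Symmetrized.ext
    (show (x.pos * y.pos + x.neg * y.neg) * z.pos + (x.pos * y.neg + x.neg * y.pos) * z.neg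
      = x.pos * (y.pos * z.pos + y.neg * z.neg) + x.neg * (y.pos * z.neg + y.neg * z.pos) by ring)
    (show (x.pos * y.pos + x.neg * y.neg) * z.neg + (x.pos * y.neg + x.neg * y.pos) * z.pos
      = x.pos * (y.pos * z.neg + y.neg * z.pos) + x.neg * (y.pos * z.pos + y.neg * z.neg) by ring)
  mul_comm x y := Symmetrized.ext
    (show x.pos * y.pos + x.neg * y.neg = y.pos * x.pos + y.neg * x.neg by ring)
    (show x.pos * y.neg + x.neg * y.pos = y.pos * x.neg + y.neg * x.pos by ring)
  left_distrib x y z := Symmetrized.ext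
    (show x.pos * (y.pos + z.pos) + x.neg * (y.neg + z.neg)
      = (x.pos * y.pos + x.neg * y.neg) + (x.pos * z.pos + x.neg * z.neg) by ring)
    (show x.pos * (y.neg + z.neg) + x.neg * (y.pos + z.pos)
      = (x.pos * y.neg + x.neg * y.pos) + (x.pos * z.neg + x.neg * z.pos) by ring)
  right_distrib x y z := Symmetrized.ext
    (show (x.pos + y.pos) * z.pos + (x.neg + y.neg) * z.neg
      = (x.pos * z.pos + x.neg * z.neg) + (y.pos * z.pos + y.neg * z.neg) by ring)
    (show (x.pos + y.pos) * z.neg + (x.neg + y.neg) * z.pos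
      = (x.pos * z.neg + x.neg * z.pos) + (y.pos * z.neg + y.neg * z.pos) by ring)
  zero_mul x := Symmetrized.ext (show 0 * x.pos + 0 * x.neg = 0 by ring)
    (show 0 * x.neg + 0 * x.pos = 0 by ring)
  mul_zero x := Symmetrized.ext (show x.pos * 0 + x.neg * 0 = 0 by ring)
    (show x.pos * 0 + x.neg * 0 = 0 by ring)
  one_mul x := Symmetrized.ext (show 1 * x.pos + 0 * x.neg = x.pos by ring)
    (show 1 * x.neg + 0 * x.pos = x.neg by ring)
  mul_one x := Symmetrized.ext (show x.pos * 1 + x.neg * 0 = x.pos by ring)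
    (show x.pos * 0 + x.neg * 1 = x.neg by ring)

@[simp] theorem pos_add (x y : Symmetrized N) : (x + y).pos = x.pos + y.pos := rfl
@[simp] theorem neg_add (x y : Symmetrized N) : (x + y).neg = x.neg + y.neg := rfl
@[simp] theorem pos_zero : (0 : Symmetrized N).pos = 0 := rfl
@[simp] theorem neg_zero : (0 : Symmetrized N).neg = 0 := rfl
@[simp] theorem pos_mul (x y : Symmetrized N) :
    (x * y).pos = x.pos * y.pos + x.neg * y.neg := rfl
@[simp] theorem neg_mul (x y : Symmetrized N) :
    (x * y).neg = x.pos * y.neg + x.neg * y.pos := rfl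
@[simp] theorem pos_one : (1 : Symmetrized N).pos = 1 := rfl
@[simp] theorem neg_one : (1 : Symmetrized N).neg = 0 := rfl

instance : SymmetrySemiring (Symmetrized N) where
  neg x := ⟨x.neg, x.pos⟩
  symm_add _ _ := rfl
  symm_zero := rfl
  symm_mul_right _ _ := Symmetrized.ext rfl rfl
  symm_mul_left x y := Symmetrized.ext (add_comm (x.pos * y.neg) (x.neg * y.pos))
    (add_comm (x.pos * y.pos) (x.neg * y.neg))
  symm_symm _ := rfl

@[simp] theorem pos_symm (x : Symmetrized N) : (-x).pos = x.neg := rfl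
@[simp] theorem neg_symm (x : Symmetrized N) : (-x).neg = x.pos := rfl

/-- The embedding `a ↦ a ⊖ 0`. -/
def of : N →+* Symmetrized N where
  toFun a := ⟨a, 0⟩
  map_one' := rfl
  map_mul' a b := Symmetrized.ext (by simp) (by simp)
  map_zero' := rfl
  map_add' a b := Symmetrized.ext (by simp) (by simp)

@[simp] theorem pos_of (a : N) : (of a).pos = a := rfl
@[simp] theorem neg_of (a : N) : (of a).neg = 0 := rfl

section Lift

variable {S : Type*} [SymmetrySemiring S]

/-- The universal property of the symmetrization: `a ⊖ b ↦ g a + -(g b)`. -/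
def lift (g : N →+* S) : Symmetrized N →+* S where
  toFun x := g x.pos + -g x.neg
  map_one' := by simp [SymmetrySemiring.symm_zero]
  map_mul' x y := by
    have h : ∀ a b : S, -a * -b = a * b := fun a b => by
      rw [← SymmetrySemiring.symm_mul_left, ← SymmetrySemiring.symm_mul_right,
        SymmetrySemiring.symm_symm]
    simp only [pos_mul, neg_mul, map_add, map_mul, SymmetrySemiring.symm_add, add_mul, mul_add, h]
    rw [← SymmetrySemiring.symm_mul_left, ← SymmetrySemiring.symm_mul_right]
    ac_rfl
  map_zero' := by simp [SymmetrySemiring.symm_zero]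
  map_add' x y := by
    simp only [pos_add, neg_add, map_add, SymmetrySemiring.symm_add]
    ac_rfl

theorem lift_apply (g : N →+* S) (x : Symmetrized N) : lift g x = g x.pos + -g x.neg := rfl

theorem lift_symm (g : N →+* S) (x : Symmetrized N) : lift g (-x) = -lift g x := by
  simp only [lift_apply, pos_symm, neg_symm, SymmetrySemiring.symm_add,
    SymmetrySemiring.symm_symm]
  exact add_comm _ _

theorem lift_of (g : N →+* S) (a : N) : lift g (of a) = g a := by
  simp [lift_apply, SymmetrySemiring.symm_zero]

theorem lift_circ (g : N →+* S) (x : Symmetrized N) : lift g (circ x) = circ (lift g x) := by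
  rw [circ, map_add, lift_symm, circ]

end Lift

end Symmetrized

/-! ### Transfer of polynomial identities -/

section Transfer

open MvPolynomial

variable {τ : Type*}

/-- If `a - b = a' - b'` in `ℤ[x]`, then the two formal differences have a common reduced part
`p ⊖ q`, obtained by cancelling coefficientwise minima. -/
theorem exists_common_reduction (a b a' b' : MvPolynomial τ ℕ) (h : a + b' = a' + b) :
    ∃ p q c c' : MvPolynomial τ ℕ, a = p + c ∧ b = q + c ∧ a' = p + c' ∧ b' = q + c' := by
  classical
  have key : ∀ f : (τ →₀ ℕ) → ℕ, ∀ s : Finset (τ →₀ ℕ), ∀ m, (m ∉ s → f m = 0) →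
      coeff m (∑ k ∈ s, monomial k (f k)) = f m := by
    intro f s m hm
    simp only [coeff_sum, coeff_monomial, Finset.sum_ite_eq']
    split_ifs with hs
    · rfl
    · exact (hm hs).symm
  have ha : ∀ a : MvPolynomial τ ℕ, ∀ m, m ∉ a.support → coeff m a = 0 := fun a m hm =>
    notMem_support_iff.1 hm
  refine ⟨∑ k ∈ a.support, monomial k (coeff k a - coeff k b),
    ∑ k ∈ b.support, monomial k (coeff k b - coeff k a),
    ∑ k ∈ a.support, monomial k (min (coeff k a) (coeff k b)),
    ∑ k ∈ a'.support, monomial k (min (coeff k a') (coeff k b')), ?_, ?_, ?_, ?_⟩ <;>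
  · ext m
    have hm := congrArg (coeff m) h
    simp only [coeff_add] at hm ⊢
    rw [key (fun k => _) _ _ fun hs => ?_, key (fun k => _) _ _ fun hs => ?_]
    · omega
    all_goals simp [ha _ _ hs]

/-- The image in `ℤ[x]` of a formal difference of polynomials with natural coefficients. -/
noncomputable def toIntPoly : Symmetrized (MvPolynomial τ ℕ) →+* MvPolynomial τ ℤ :=
  letI := ringSymmetry (MvPolynomial τ ℤ)
  Symmetrized.lift (MvPolynomial.map (Nat.castRingHom ℤ))

theorem toIntPoly_symm (x : Symmetrized (MvPolynomial τ ℕ)) : toIntPoly (-x) = -toIntPoly x :=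
  letI := ringSymmetry (MvPolynomial τ ℤ)
  Symmetrized.lift_symm _ x

theorem pos_add_neg_of_toIntPoly_eq {P Q : Symmetrized (MvPolynomial τ ℕ)}
    (h : toIntPoly P = toIntPoly Q) : P.pos + Q.neg = Q.pos + P.neg := by
  apply MvPolynomial.map_injective (Nat.castRingHom ℤ) Nat.cast_injective
  have h' : MvPolynomial.map (Nat.castRingHom ℤ) P.pos + -MvPolynomial.map (Nat.castRingHom ℤ) P.neg
    = MvPolynomial.map (Nat.castRingHom ℤ) Q.pos
      + -MvPolynomial.map (Nat.castRingHom ℤ) Q.neg := h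
  rw [map_add, map_add]
  linear_combination h'

open Symmetrized in
/-- Two formal differences with the same image in `ℤ[x]` have a common part, up to elements
of the form `c°`. -/
theorem exists_common_part {P Q : Symmetrized (MvPolynomial τ ℕ)}
    (h : toIntPoly P = toIntPoly Q) :
    ∃ (r : Symmetrized (MvPolynomial τ ℕ)) (c c' : MvPolynomial τ ℕ),
      P = r + circ (of c) ∧ Q = r + circ (of c') := by
  obtain ⟨p, q, c, c', h1, h2, h3, h4⟩ :=
    exists_common_reduction _ _ _ _ (pos_add_neg_of_toIntPoly_eq h)
  exact ⟨⟨p, q⟩, c, c', by ext1 <;> simp [circ, h1, h2], by ext1 <;> simp [circ, h3, h4]⟩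

open Symmetrized in
/-- If `Q` is a signed sum of pairwise distinct monomials, no cancellation occurs in `Q`, and an
identity `P = Q` of integral polynomials becomes `P = Q + c°`. -/
theorem exists_eq_add_circ {K : Type*} [Fintype K] (m : K → τ →₀ ℕ) (hm : Function.Injective m)
    (s : K → ℕ) {P Q : Symmetrized (MvPolynomial τ ℕ)}
    (hQ : Q = ∑ k, (-1) ^ s k * of (monomial (m k) 1)) (h : toIntPoly P = toIntPoly Q) :
    ∃ c : MvPolynomial τ ℕ, P = Q + circ (of c) := by
  classical
  have hsign : ∀ k : ℕ, ((-1 : Symmetrized (MvPolynomial τ ℕ)) ^ k) = if Even k then 1 else -1 := by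
    intro k
    split_ifs with hk
    · obtain ⟨l, rfl⟩ := hk
      exact neg_one_pow_add_self l
    · obtain ⟨l, rfl⟩ := Nat.not_even_iff_odd.1 hk
      rw [pow_succ, two_mul, neg_one_pow_add_self, one_mul]
  have hpos : Q.pos = ∑ k, if Even (s k) then monomial (m k) 1 else 0 := by
    let f : Symmetrized (MvPolynomial τ ℕ) →+ MvPolynomial τ ℕ := ⟨⟨pos, rfl⟩, fun _ _ => rfl⟩
    rw [show Q.pos = f Q from rfl, hQ, map_sum]
    refine Finset.sum_congr rfl fun k _ => ?_
    rw [hsign]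
    split_ifs <;> simp [f]
  have hneg : Q.neg = ∑ k, if Even (s k) then 0 else monomial (m k) 1 := by
    let f : Symmetrized (MvPolynomial τ ℕ) →+ MvPolynomial τ ℕ := ⟨⟨neg, rfl⟩, fun _ _ => rfl⟩
    rw [show Q.neg = f Q from rfl, hQ, map_sum]
    refine Finset.sum_congr rfl fun k _ => ?_
    rw [hsign]
    split_ifs <;> simp [f]
  obtain ⟨r, c, c', hP, hQ'⟩ := exists_common_part h
  suffices hc : c' = 0 by
    refine ⟨c, ?_⟩
    rw [hQ', hc, map_zero, circ_zero, add_zero, hP]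
  ext d
  by_contra hd
  rw [coeff_zero] at hd
  have h1 : coeff d Q.pos ≠ 0 := by
    rw [hQ']; simp [circ]; tauto
  have h2 : coeff d Q.neg ≠ 0 := by
    rw [hQ']; simp [circ]; tauto
  rw [hpos, coeff_sum] at h1
  rw [hneg, coeff_sum] at h2
  obtain ⟨k, -, hk⟩ := Finset.exists_ne_zero_of_sum_ne_zero h1
  obtain ⟨l, -, hl⟩ := Finset.exists_ne_zero_of_sum_ne_zero h2
  split_ifs at hk with hk'
  swap
  · simp at hk
  split_ifs at hl with hl'
  · simp at hl
  rw [coeff_monomial] at hk hl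
  have e1 : m k = d := by by_contra hne; simp [hne] at hk
  have e2 : m l = d := by by_contra hne; simp [hne] at hl
  rw [hm (e1.trans e2.symm)] at hk'
  exact hl' hk'

end Transfer

/-! ### Laplace expansion and the Cauchy–Binet relation -/

section Generic

open MvPolynomial Symmetrized

variable {S : Type*} [SymmetrySemiring S] {τ : Type*}

/-- Evaluation of a formal difference of polynomials at a point of a semiring with symmetry. -/
noncomputable def evalAt (a : τ → S) : Symmetrized (MvPolynomial τ ℕ) →+* S :=
  lift (eval₂Hom (Nat.castRingHom S) a)

theorem evalAt_symm (a : τ → S) (x : Symmetrized (MvPolynomial τ ℕ)) :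
    evalAt a (-x) = -evalAt a x := lift_symm _ _

theorem evalAt_of (a : τ → S) (p : MvPolynomial τ ℕ) :
    evalAt a (of p) = eval₂Hom (Nat.castRingHom S) a p := lift_of _ _

theorem evalAt_circ (a : τ → S) (x : Symmetrized (MvPolynomial τ ℕ)) :
    evalAt a (circ x) = circ (evalAt a x) := lift_circ _ _

/-- The matrix of variables `X (f i j)`. -/
noncomputable def varMatrix {n : ℕ} (f : Fin n → Fin n → τ) :
    Matrix (Fin n) (Fin n) (Symmetrized (MvPolynomial τ ℕ)) := fun i j => of (X (f i j))

theorem varMatrix_map {n : ℕ} (f : Fin n → Fin n → τ) (a : τ → S) :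
    (varMatrix f).map (evalAt a) = fun i j => a (f i j) := by
  ext i j
  simp [varMatrix, evalAt_of]

theorem det_varMatrix {n : ℕ} (f : Fin n → Fin n → τ) :
    det (varMatrix f) = ∑ σ : Equiv.Perm (Fin n), (-1) ^ (inversions σ).card *
      of (monomial (∑ i, Finsupp.single (f i (σ i)) 1) 1) := by
  refine Finset.sum_congr rfl fun σ _ => ?_
  congr 1
  simp only [varMatrix]
  rw [← map_prod]
  congr 1
  rw [MvPolynomial.monomial_sum_one]
  rfl

theorem toIntPoly_det {n : ℕ} (B : Matrix (Fin n) (Fin n) (Symmetrized (MvPolynomial τ ℕ))) :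
    toIntPoly (det B) = (B.map toIntPoly).det := by
  let := ringSymmetry (MvPolynomial τ ℤ)
  rw [← det_ringSymmetry]
  exact map_det toIntPoly toIntPoly_symm B

theorem toIntPoly_adj {n : ℕ} (B : Matrix (Fin n) (Fin n) (Symmetrized (MvPolynomial τ ℕ))) :
    (adj B).map toIntPoly = (B.map toIntPoly).adjugate := by
  let := ringSymmetry (MvPolynomial τ ℤ)
  rw [← adj_ringSymmetry]
  exact map_adj toIntPoly toIntPoly_symm B

/-- A polynomial with natural coefficients which vanishes at a natural point `a` has only monomials
involving a zero of `a`, hence it vanishes at every `b` which is zero wherever `a` is. -/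
theorem eval_eq_zero_of_eval_nat {R : Type*} [CommSemiring R] {a : τ → ℕ} {b : τ → R}
    (hab : ∀ x, a x = 0 → b x = 0) {c : MvPolynomial τ ℕ}
    (h : eval₂Hom (Nat.castRingHom ℕ) a c = 0) : eval₂Hom (Nat.castRingHom R) b c = 0 := by
  rw [coe_eval₂Hom, eval₂_eq] at h ⊢
  refine Finset.sum_eq_zero fun d hd => ?_
  have hd' := (Finset.sum_eq_zero_iff.1 h) d hd
  rcases mul_eq_zero.1 hd' with h1 | h1
  · exact absurd h1 (by simpa using hd)
  · obtain ⟨x, hx, h2⟩ := Finset.prod_eq_zero_iff.1 h1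
    rw [Finset.prod_eq_zero hx, mul_zero]
    rw [hab x (pow_eq_zero_iff (Finsupp.mem_support_iff.1 hx) |>.1 h2),
      zero_pow (Finsupp.mem_support_iff.1 hx)]

end Generic

section Mass

variable {S : Type*} [SymmetrySemiring S]

/-- When the symmetry is trivial, evaluating at `1` counts the terms of the determinant. -/
theorem det_ones (hS : (-1 : S) = 1) {ι κ : Type*} [LinearOrder ι] [Fintype ι] [LinearOrder κ]
    [Fintype κ] : det (fun (_ : ι) (_ : κ) => (1 : S)) = Fintype.card (ι ≃ κ) := by
  simp [det, sign, hS]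

theorem sum_mul_adj_ones (hS : (-1 : S) = 1) {n : ℕ} (i : Fin n) :
    ∑ j, (1 : S) * adj (fun _ _ => (1 : S)) j i = det (fun (_ _ : Fin n) => (1 : S)) := by
  have hm : ∀ j, adj (fun _ _ : Fin n => (1 : S)) j i = ((n - 1).factorial : ℕ) := fun j => by
    have e : {x // x ≠ i} ≃ {x // x ≠ j} := Fintype.equivOfCardEq (by simp)
    simp only [adj, hS, one_pow, one_mul, minor]
    refine (det_ones hS).trans (congrArg Nat.cast ?_)
    rw [← Nat.card_eq_fintype_card, Nat.card_eq_fintype_card, Fintype.card_equiv e]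
    simp
  rw [det_ones hS, Fintype.card_perm, Fintype.card_fin]
  simp only [hm, one_mul, Finset.sum_const, Finset.card_univ, Fintype.card_fin, nsmul_eq_mul]
  obtain ⟨m, rfl⟩ : ∃ m, n = m + 1 := ⟨n - 1, by have := i.2; omega⟩
  rw [← Nat.cast_mul, Nat.add_sub_cancel, Nat.factorial_succ]

end Mass

section Expansions

open MvPolynomial Symmetrized

variable {S : Type*} [SymmetrySemiring S] {n : ℕ}

/-- The monomials `∏ i, x_{i, σ i}` of the determinant are pairwise distinct. -/
theorem injective_graph : Function.Injective fun σ : Equiv.Perm (Fin n) =>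
    ∑ i, Finsupp.single (i, σ i) 1 := by
  intro σ ρ h
  ext1 i
  have h1 := DFunLike.congr_fun h (i, σ i)
  simp only [Finsupp.coe_finsetSum, Finset.sum_apply, Finsupp.single_apply, Prod.mk.injEq] at h1
  by_contra hne
  rw [Finset.sum_eq_single i (by intro j _ hj; simp [hj]) (by simp),
    Finset.sum_eq_zero (by
      rintro j -
      rw [if_neg]
      rintro ⟨rfl, h2⟩
      exact hne h2.symm)] at h1
  simp at h1

/-- Laplace expansion along a row. Over the generic matrix, both sides agree up to some `c°`, and
they have the same number of terms, so that `c` vanishes. -/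
theorem mul_adj_diag (A : Matrix (Fin n) (Fin n) S) (i : Fin n) : (A * adj A) i i = det A := by
  let V := varMatrix (Prod.mk : Fin n → Fin n → _)
  have hZ : toIntPoly ((V * adj V) i i) = toIntPoly (det V) := by
    have h := congrFun (congrFun (Matrix.mul_adjugate (V.map toIntPoly)) i) i
    rw [← toIntPoly_adj, ← Matrix.map_mul] at h
    simpa [toIntPoly_det] using h
  obtain ⟨c, hc⟩ := exists_eq_add_circ _ injective_graph _ (det_varMatrix _) hZ
  have hc0 : c = 0 := by
    -- With the trivial symmetry on `ℕ`, evaluation at `1` counts terms, those of `c` twice.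
    have hmass : eval₂Hom (Nat.castRingHom ℕ) (fun _ => 1) c = 0 := by
      let := trivialSymmetry ℕ
      have h := congrArg (evalAt (fun _ => (1 : ℕ))) hc
      have hones : V.map (evalAt (fun _ => (1 : ℕ))) = fun _ _ => 1 := varMatrix_map _ _
      rw [map_add, evalAt_circ, evalAt_of, map_det _ (evalAt_symm _), hones,
        Matrix.mul_apply, map_sum] at h
      have hl : ∀ j, evalAt (fun _ => (1 : ℕ)) (V i j * adj V j i)
          = 1 * adj (fun _ _ => (1 : ℕ)) j i := by
        intro j
        have h1 : evalAt (fun _ => (1 : ℕ)) (V i j) = 1 := congrFun (congrFun hones i) j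
        have h2 := congrFun (congrFun (map_adj _ (evalAt_symm (fun _ => (1 : ℕ))) V) j) i
        rw [hones] at h2
        rw [map_mul, h1]
        exact congrArg (1 * ·) h2
      rw [Finset.sum_congr rfl fun j _ => hl j, sum_mul_adj_ones rfl] at h
      simp only [circ] at h
      have h' : ∀ a b : ℕ, a = a + (b + b) → b = 0 := by omega
      exact h' _ _ h
    have h0 := eval_eq_zero_of_eval_nat (b := (X : _ → MvPolynomial (Fin n × Fin n) ℕ)) (by simp)
      hmass
    have hid : eval₂Hom (Nat.castRingHom _) (X : _ → MvPolynomial (Fin n × Fin n) ℕ)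
        = RingHom.id _ := by
      ext <;> simp
    rwa [hid] at h0
  rw [hc0, map_zero, circ_zero, add_zero] at hc
  have h := congrArg (evalAt (fun p : Fin n × Fin n => A p.1 p.2)) hc
  have hV : V.map (evalAt (fun p : Fin n × Fin n => A p.1 p.2)) = A := varMatrix_map _ _
  rw [map_det _ (evalAt_symm _), hV] at h
  rw [← h, ← hV, ← map_adj _ (evalAt_symm _), ← Matrix.map_mul, hV]
  rfl

/-- The Cauchy–Binet relation: the terms of `det X * det Y` are distinct monomials, so that the only
other terms of `det (X * Y)` form some `c°`. -/
theorem circGE_det_mul (A B : Matrix (Fin n) (Fin n) S) :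
    CircGE (det (A * B)) (det A * det B) := by
  let V := varMatrix (fun i j : Fin n => (Sum.inl (i, j) : (Fin n × Fin n) ⊕ (Fin n × Fin n)))
  let W := varMatrix (fun i j : Fin n => (Sum.inr (i, j) : (Fin n × Fin n) ⊕ (Fin n × Fin n)))
  have hZ : toIntPoly (det (V * W)) = toIntPoly (det V * det W) := by
    rw [map_mul, toIntPoly_det, toIntPoly_det, toIntPoly_det, Matrix.map_mul, Matrix.det_mul]
  have hQ : det V * det W = ∑ p : Equiv.Perm (Fin n) × Equiv.Perm (Fin n),
      (-1) ^ ((inversions p.1).card + (inversions p.2).card) *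
        of (monomial ((∑ i, Finsupp.single (Sum.inl (i, p.1 i)) 1) +
          ∑ i, Finsupp.single (Sum.inr (i, p.2 i)) 1) 1) := by
    rw [det_varMatrix, det_varMatrix, Finset.sum_mul_sum, Fintype.sum_prod_type]
    refine Finset.sum_congr rfl fun σ _ => Finset.sum_congr rfl fun ρ _ => ?_
    have hmon : ∀ d e : (Fin n × Fin n) ⊕ (Fin n × Fin n) →₀ ℕ,
        (monomial (d + e) 1 : MvPolynomial _ ℕ) = monomial d 1 * monomial e 1 := fun d e => by
      rw [monomial_mul, one_mul]
    rw [pow_add, hmon, map_mul of]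
    ring
  have hinj : Function.Injective fun p : Equiv.Perm (Fin n) × Equiv.Perm (Fin n) =>
      ((∑ i, Finsupp.single (Sum.inl (i, p.1 i)) 1) +
        ∑ i, Finsupp.single (Sum.inr (i, p.2 i)) 1 :
        (Fin n × Fin n) ⊕ (Fin n × Fin n) →₀ ℕ) := by
    intro p q h
    refine Prod.ext (injective_graph ?_) (injective_graph ?_)
    · ext x
      have h1 := DFunLike.congr_fun h (Sum.inl x)
      simpa [Finsupp.single_apply] using h1
    · ext x
      have h1 := DFunLike.congr_fun h (Sum.inr x)
      simpa [Finsupp.single_apply] using h1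
  obtain ⟨c, hc⟩ := exists_eq_add_circ _ hinj _ hQ hZ
  let a : (Fin n × Fin n) ⊕ (Fin n × Fin n) → S := Sum.elim (fun p => A p.1 p.2) fun p => B p.1 p.2
  have h := congrArg (evalAt a) hc
  have hV : V.map (evalAt a) = A := varMatrix_map _ _
  have hW : W.map (evalAt a) = B := varMatrix_map _ _
  rw [map_add, map_mul, evalAt_circ, map_det _ (evalAt_symm _), map_det _ (evalAt_symm _),
    map_det _ (evalAt_symm _), Matrix.map_mul, hV, hW] at h
  exact circGE_iff.2 ⟨_, h⟩

end Expansions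

/-! ### Totally ordered idempotent semirings and the modulus -/

section Idempotent

variable {M : Type*} [CommSemiring M] (hM : IsTotallyOrderedIdempotent M)
include hM

theorem natLE_iff_add_eq {a b : M} : NatLE a b ↔ a + b = b :=
  ⟨fun ⟨c, hc⟩ => by rw [hc, ← add_assoc, hM.add_idem], fun h => ⟨b, h.symm⟩⟩

theorem natLE_antisymm {a b : M} (h : NatLE a b) (h' : NatLE b a) : a = b := by
  rw [natLE_iff_add_eq hM] at h h'
  rw [← h, add_comm, h']

theorem sum_natLE {ι : Type*} (s : Finset ι) (f : ι → M) (b : M) (h : ∀ i ∈ s, NatLE (f i) b) :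
    NatLE (∑ i ∈ s, f i) b := by
  classical
  induction s using Finset.induction_on with
  | empty => exact ⟨b, by simp⟩
  | insert i s hi ih =>
    rw [Finset.sum_insert hi, ← hM.add_idem b]
    exact (h i (Finset.mem_insert_self i s)).add
      (ih fun j hj => h j (Finset.mem_insert_of_mem hj))

theorem exists_sum_eq {ι : Type*} {s : Finset ι} (hs : s.Nonempty) (f : ι → M) :
    ∃ i ∈ s, ∑ j ∈ s, f j = f i := by
  classical
  induction hs using Finset.Nonempty.cons_induction with
  | singleton i => exact ⟨i, by simp⟩
  | cons i s hi hs ih =>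
    obtain ⟨j, hj, h⟩ := ih
    rw [Finset.sum_cons, h]
    rcases hM.total (f i) (f j) with h' | h'
    · exact ⟨j, by simp [hj], (natLE_iff_add_eq hM).1 h'⟩
    · exact ⟨i, by simp, by rw [add_comm]; exact (natLE_iff_add_eq hM).1 h'⟩

/-- In a totally ordered idempotent semiring `1` is the only square root of `1`, so that a modulus
does not see the symmetry. -/
theorem map_symm {T : Type*} [SymmetrySemiring T] (μ : T →+* M) (a : T) : μ (-a) = μ a := by
  have h1 : μ (-1) * μ (-1) = 1 := by rw [← map_mul, neg_one_mul_neg_one, map_one]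
  have h2 : μ (-1) = 1 := by
    rcases hM.total (μ (-1)) 1 with h | h
    · have h3 := h.mul (NatLE.refl (μ (-1)))
      rw [h1, one_mul] at h3
      exact natLE_antisymm hM h h3
    · have h3 := h.mul (NatLE.refl (μ (-1)))
      rw [h1, one_mul] at h3
      exact natLE_antisymm hM h3 h
  rw [symm_eq_mul, map_mul, h2, one_mul]

end Idempotent

/-! ### Comparison with powers of an invertible determinant -/

section Power

open MvPolynomial Symmetrized

theorem natLE_symm {S : Type*} [SymmetrySemiring S] {a b : S} (h : NatLE a b) :
    NatLE (-a) (-b) := by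
  rw [symm_eq_mul a, symm_eq_mul b]
  exact (NatLE.refl _).mul h

theorem natLE_eval₂Hom {R τ : Type*} [CommSemiring R] {a b : τ → R} (h : ∀ x, NatLE (a x) (b x))
    (p : MvPolynomial τ ℕ) :
    NatLE (eval₂Hom (Nat.castRingHom R) a p) (eval₂Hom (Nat.castRingHom R) b p) := by
  induction p using MvPolynomial.induction_on with
  | C k => simpa using NatLE.refl _
  | add p q hp hq => rw [map_add, map_add]; exact hp.add hq
  | mul_X p x hp => rw [map_mul, map_mul]; exact hp.mul (by simpa using h x)

variable {S : Type*} [SymmetrySemiring S] {n : ℕ}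

theorem natLE_evalAt {τ : Type*} {a b : τ → S} (h : ∀ x, NatLE (a x) (b x))
    (P : Symmetrized (MvPolynomial τ ℕ)) : NatLE (evalAt a P) (evalAt b P) :=
  (natLE_eval₂Hom h _).add (natLE_symm (natLE_eval₂Hom h _))

/-- The restriction of `A` to the graph of a permutation, with zeros elsewhere. -/
def restrictGraph (σ : Equiv.Perm (Fin n)) (A : Matrix (Fin n) (Fin n) S) :
    Matrix (Fin n) (Fin n) S := fun i j => if j = σ i then A i j else 0

theorem det_restrictGraph (σ : Equiv.Perm (Fin n)) (A : Matrix (Fin n) (Fin n) S) :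
    det (restrictGraph σ A) = sign S σ * ∏ i, A i (σ i) := by
  unfold det
  rw [Finset.sum_eq_single σ]
  · simp [restrictGraph]
  · intro ρ _ hρ
    obtain ⟨i, hi⟩ : ∃ i, ρ i ≠ σ i := by
      by_contra! h
      exact hρ (Equiv.ext h)
    rw [Finset.prod_eq_zero (Finset.mem_univ i) (by simp [restrictGraph, hi]), mul_zero]
  · simp

variable {M : Type*} [CommSemiring M]

/-- An invertible determinant is equal to one of the terms of its expansion: a term of maximal
modulus, by rigidity. -/
theorem exists_det_restrictGraph_eq (hM : IsTotallyOrderedIdempotent M) (μ : S →+* M)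
    (hrigid : ∀ a b : S, NatLE a b → μ a = μ b → (IsUnit b ∨ b = 0) → a = b)
    {A : Matrix (Fin n) (Fin n) S} (hA : IsUnit (det A)) :
    ∃ σ, det (restrictGraph σ A) = det A := by
  obtain ⟨σ, -, hσ⟩ := exists_sum_eq hM (Finset.univ_nonempty (α := Equiv.Perm (Fin n)))
    fun σ => μ (sign S σ * ∏ i, A i (σ i))
  refine ⟨σ, ?_⟩
  rw [det_restrictGraph]
  refine hrigid _ _ (natLE_sum (fun σ : Equiv.Perm (Fin n) => sign S σ * ∏ i, A i (σ i)) σ) ?_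
    (Or.inl hA)
  rw [← hσ, ← map_sum]
  rfl

theorem det_pow_eq_evalAt {k : ℕ} {r : Symmetrized (MvPolynomial (Fin n × Fin n) ℕ)}
    {c : MvPolynomial (Fin n × Fin n) ℕ} (h : det (varMatrix Prod.mk) ^ k = r + circ (of c))
    (B : Matrix (Fin n) (Fin n) S) :
    det B ^ k = evalAt (fun p => B p.1 p.2) r
      + circ (eval₂Hom (Nat.castRingHom S) (fun p => B p.1 p.2) c) := by
  rw [← evalAt_of, ← evalAt_circ, ← map_add, ← h, map_pow, map_det _ (evalAt_symm _),
    varMatrix_map]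

/-- An identity `P = det(X) ^ k` of integral polynomials becomes `P(A) ⪰° det(A) ^ k` as soon as
`det(A)` equals one term of its expansion. Write `P = r + c°` and `det(X) ^ k = r + c'°` over
formal differences. On the graph of the optimal permutation, `det(X) ^ k` is a single monomial,
so `c'` vanishes there and `det(A) ^ k ≼ r(A)`; conversely, `r(A) ≼ det(A) ^ k`. -/
theorem circGE_det_pow (hS : NaturallyOrdered S) {A : Matrix (Fin n) (Fin n) S}
    {σ : Equiv.Perm (Fin n)} (hσ : det (restrictGraph σ A) = det A) (k : ℕ)
    {P : Symmetrized (MvPolynomial (Fin n × Fin n) ℕ)}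
    (hP : toIntPoly P = toIntPoly (det (varMatrix Prod.mk) ^ k)) :
    CircGE (evalAt (fun p => A p.1 p.2) P) (det A ^ k) := by
  obtain ⟨r, c, c', h1, h2⟩ := exists_common_part hP
  have hmass : eval₂Hom (Nat.castRingHom ℕ) (fun p => if p.2 = σ p.1 then 1 else 0) c' = 0 := by
    let := trivialSymmetry ℕ
    have h : det (restrictGraph σ (Matrix.of fun _ _ => (1 : ℕ))) ^ k = 1 := by
      rw [det_restrictGraph, sign]
      change ((1 : ℕ) ^ _ * _) ^ k = 1
      simp
    -- The single term is split between `r` and `c'°`, where `c'` counts twice.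
    rw [det_pow_eq_evalAt h2, circ] at h
    have h' : ∀ a b : ℕ, a + (b + b) = 1 → b = 0 := by omega
    exact h' _ _ h
  have hc' : eval₂Hom (Nat.castRingHom S) (fun p => restrictGraph σ A p.1 p.2) c' = 0 :=
    eval_eq_zero_of_eval_nat (fun x hx => if_neg fun h => by simp [h] at hx) hmass
  have hr : evalAt (fun p => A p.1 p.2) r = det A ^ k := by
    refine hS _ _ ⟨_, det_pow_eq_evalAt h2 A⟩ ?_
    have h := det_pow_eq_evalAt h2 (restrictGraph σ A)
    rw [hc', circ_zero, add_zero, hσ] at h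
    rw [h]
    refine natLE_evalAt (fun p => ?_) r
    by_cases hp : p.2 = σ p.1
    · simpa [restrictGraph, hp] using NatLE.refl _
    · exact ⟨A p.1 p.2, by simp [restrictGraph, hp]⟩
  rw [h1, map_add, evalAt_circ, hr]
  exact circGE_iff.2 ⟨_, rfl⟩

theorem circGE_det_adj (hS : NaturallyOrdered S) {A : Matrix (Fin n) (Fin n) S}
    {σ : Equiv.Perm (Fin n)} (hσ : det (restrictGraph σ A) = det A) :
    CircGE (det (adj A)) (det A ^ (n - 1)) := by
  have h := circGE_det_pow hS hσ (n - 1) (P := det (adj (varMatrix Prod.mk))) (by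
    rw [map_pow, toIntPoly_det, toIntPoly_det, toIntPoly_adj, Matrix.det_adjugate,
      Fintype.card_fin])
  rwa [map_det _ (evalAt_symm _), map_adj _ (evalAt_symm _), varMatrix_map] at h

theorem circGE_det_mul_adj (hS : NaturallyOrdered S) {A : Matrix (Fin n) (Fin n) S}
    {σ : Equiv.Perm (Fin n)} (hσ : det (restrictGraph σ A) = det A) :
    CircGE (det (A * adj A)) (det A ^ n) := by
  have h := circGE_det_pow hS hσ n
    (P := det (varMatrix Prod.mk * adj (varMatrix Prod.mk))) (by
      rw [map_pow, toIntPoly_det, toIntPoly_det, Matrix.map_mul, toIntPoly_adj,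
        Matrix.mul_adjugate, Matrix.det_smul, Matrix.det_one, mul_one, Fintype.card_fin])
  rwa [map_det _ (evalAt_symm _), Matrix.map_mul, map_adj _ (evalAt_symm _), varMatrix_map] at h

end Power

/-! ### Homogeneous polynomials and the permanent -/

section Homogeneous

open MvPolynomial

variable {n : ℕ}

/-- The weight of the variable `x_{ij}` which records row degrees and column degrees: one in row `i`
and one in column `j`. -/
def bidegree (p : Fin n × Fin n) : (Fin n → ℕ) × (Fin n → ℕ) :=
  (Pi.single p.1 1, Pi.single p.2 1)

/-- An exponent matrix with all row and column sums equal to `k + 1` dominates a permutation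
matrix. -/
theorem exists_perm_of_regular {k : ℕ} (E : Fin n → Fin n → ℕ) (hr : ∀ i, ∑ j, E i j = k + 1)
    (hc : ∀ j, ∑ i, E i j = k + 1) : ∃ σ : Equiv.Perm (Fin n), ∀ i, E i (σ i) ≠ 0 := by
  classical
  have hall : ∀ s : Finset (Fin n),
      s.card ≤ (s.biUnion fun i => Finset.univ.filter fun j => E i j ≠ 0).card := by
    intro s
    set t := s.biUnion fun i => Finset.univ.filter fun j => E i j ≠ 0 with ht
    have h : s.card * (k + 1) ≤ t.card * (k + 1) := by
      calc s.card * (k + 1) = ∑ i ∈ s, ∑ j, E i j := by simp [hr]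
        _ = ∑ i ∈ s, ∑ j ∈ t, E i j := by
          refine Finset.sum_congr rfl fun i hi => (Finset.sum_subset (Finset.subset_univ t) ?_).symm
          intro j _ hj
          by_contra hE
          exact hj (Finset.mem_biUnion.2 ⟨i, hi, by simp [hE]⟩)
        _ = ∑ j ∈ t, ∑ i ∈ s, E i j := Finset.sum_comm
        _ ≤ ∑ j ∈ t, ∑ i, E i j :=
          Finset.sum_le_sum fun j _ => Finset.sum_le_sum_of_subset (Finset.subset_univ s)
        _ = t.card * (k + 1) := by simp [hc]
    exact Nat.le_of_mul_le_mul_right h k.succ_pos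
  obtain ⟨f, hf, hE⟩ := (Finset.all_card_le_biUnion_card_iff_exists_injective _).1 hall
  refine ⟨Equiv.ofBijective f (Finite.injective_iff_bijective.1 hf), fun i => ?_⟩
  simpa using hE i

variable {M : Type*} [CommSemiring M]

/-- A monomial of degree `k` in each row and each column is a product of `k` permutation monomials,
each of which is a term of the permanent. -/
theorem prod_pow_natLE_permanent (B : Matrix (Fin n) (Fin n) M) :
    ∀ (k : ℕ) (E : Fin n → Fin n → ℕ), (∀ i, ∑ j, E i j = k) → (∀ j, ∑ i, E i j = k) →
      NatLE (∏ i, ∏ j, B i j ^ E i j) ((∑ σ : Equiv.Perm (Fin n), ∏ i, B i (σ i)) ^ k) := by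
  intro k
  induction k with
  | zero =>
    intro E hr _
    have h0 : ∀ i j, E i j = 0 := fun i j =>
      (Finset.sum_eq_zero_iff.1 (hr i)) j (Finset.mem_univ j)
    simpa [h0] using NatLE.refl _
  | succ k ih =>
    intro E hr hc
    obtain ⟨σ, hσ⟩ := exists_perm_of_regular E hr hc
    let D : Fin n → Fin n → ℕ := fun i j => if j = σ i then 1 else 0
    have hDE : ∀ i j, D i j ≤ E i j := fun i j => by
      simp only [D]
      split_ifs with h
      · subst h
        exact Nat.one_le_iff_ne_zero.2 (hσ i)
      · exact Nat.zero_le _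
    have hDr : ∀ i, ∑ j, D i j = 1 := fun i => by simp [D]
    have hDc : ∀ j, ∑ i, D i j = 1 := fun j => by simp [D, ← Equiv.symm_apply_eq]
    have hE : ∀ i j, E i j = D i j + (E i j - D i j) := fun i j =>
      (Nat.add_sub_cancel' (hDE i j)).symm
    have hprod : ∏ i, ∏ j, B i j ^ E i j
        = (∏ i, B i (σ i)) * ∏ i, ∏ j, B i j ^ (E i j - D i j) := by
      rw [← Finset.prod_mul_distrib]
      refine Finset.prod_congr rfl fun i _ => ?_
      rw [Finset.prod_congr rfl fun j _ => by rw [hE i j, pow_add], Finset.prod_mul_distrib]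
      simp [D]
    rw [hprod, pow_succ, mul_comm]
    refine (ih _ (fun i => ?_) fun j => ?_).mul
      (natLE_sum (fun σ : Equiv.Perm (Fin n) => ∏ i, B i (σ i)) σ)
    · have h := hr i
      rw [Finset.sum_congr rfl fun j _ => hE i j, Finset.sum_add_distrib, hDr] at h
      omega
    · have h := hc j
      rw [Finset.sum_congr rfl fun i _ => hE i j, Finset.sum_add_distrib, hDc] at h
      omega

/-- In an idempotent semiring the positive coefficients are absorbed, and it suffices to bound each
monomial. -/
theorem eval_natLE_permanent (hM : IsTotallyOrderedIdempotent M) (B : Matrix (Fin n) (Fin n) M)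
    {k : ℕ} {φ : MvPolynomial (Fin n × Fin n) ℕ}
    (hφ : IsWeightedHomogeneous bidegree φ ((fun _ => k), (fun _ => k))) :
    NatLE (eval₂Hom (Nat.castRingHom M) (fun p => B p.1 p.2) φ)
      ((∑ σ : Equiv.Perm (Fin n), ∏ i, B i (σ i)) ^ k) := by
  rw [coe_eval₂Hom, eval₂_eq']
  refine sum_natLE hM _ _ _ fun d hd => ?_
  have hdeg := hφ (mem_support_iff.1 hd)
  rw [Finsupp.weight_apply, Finsupp.sum_fintype _ _ (by simp)] at hdeg
  have hrow : ∀ i, ∑ j, d (i, j) = k := fun i => by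
    have h := congrFun (congrArg Prod.fst hdeg) i
    simp only [Prod.fst_sum, Finset.sum_apply, Prod.smul_fst, Pi.smul_apply, bidegree,
      smul_eq_mul, Fintype.sum_prod_type_right, Pi.single_apply] at h
    simpa using h
  have hcol : ∀ j, ∑ i, d (i, j) = k := fun j => by
    have h := congrFun (congrArg Prod.snd hdeg) j
    simp only [Prod.snd_sum, Finset.sum_apply, Prod.smul_snd, Pi.smul_apply, bidegree,
      smul_eq_mul, Fintype.sum_prod_type, Pi.single_apply] at h
    simpa using h
  have hcoeff : ∀ (m : ℕ) (x : M), NatLE (m * x) x := fun m x => by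
    rw [← nsmul_eq_mul, ← Finset.card_range m, ← Finset.sum_const]
    exact sum_natLE hM _ _ _ fun _ _ => NatLE.refl _
  refine (hcoeff _ _).trans ?_
  rw [Fintype.prod_prod_type]
  exact prod_pow_natLE_permanent B k (fun i j => d (i, j)) hrow hcol

end Homogeneous

/-! ### Moduli of the determinants of `adj A` and `A * adj A` -/

section Adjoint

open MvPolynomial

variable {n : ℕ}

theorem sum_single_fin : ∑ i : Fin n, Pi.single i 1 = (1 : Fin n → ℕ) := by
  ext j
  simp [Pi.single_apply]

/-- The indicator function of the indices other than `r`, written as a sum over the index type of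
the minors: the row degrees of a minor which omits row `r`, or its column degrees if it omits
column `r`. -/
def coDegree (r : Fin n) : Fin n → ℕ := ∑ i : {x // x ≠ r}, Pi.single i.1 1

theorem single_add_coDegree (r : Fin n) : Pi.single r 1 + coDegree r = 1 := by
  rw [coDegree, ← sum_single_fin,
    ← Finset.sum_subtype (Finset.univ.erase r) (by simp) (fun i => (Pi.single i 1 : Fin n → ℕ)),
    Finset.add_sum_erase _ (fun i => (Pi.single i 1 : Fin n → ℕ)) (Finset.mem_univ r)]

theorem sum_coDegree : ∑ r : Fin n, coDegree r = fun _ => n - 1 := by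
  have h := Finset.sum_congr rfl fun r (_ : r ∈ Finset.univ (α := Fin n)) => single_add_coDegree r
  rw [Finset.sum_add_distrib, sum_single_fin] at h
  ext i
  have h' := congrFun h i
  simp only [Pi.add_apply, Finset.sum_apply, Pi.one_apply, Finset.sum_const, Finset.card_univ,
    Fintype.card_fin, smul_eq_mul, mul_one] at h' ⊢
  omega

theorem isWeightedHomogeneous_minor (r c : Fin n) :
    letI := trivialSymmetry (MvPolynomial (Fin n × Fin n) ℕ)
    IsWeightedHomogeneous bidegree
      (minor (Matrix.mvPolynomialX (Fin n) (Fin n) ℕ) r c)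
      (coDegree r, coDegree c) := by
  refine IsWeightedHomogeneous.sum _ _ _ fun σ _ => ?_
  change IsWeightedHomogeneous bidegree (1 ^ _ * ∏ i : {x // x ≠ r}, X (i.1, (σ i).1)) _
  rw [one_pow, one_mul]
  have h := IsWeightedHomogeneous.prod Finset.univ
    (fun i : {x // x ≠ r} => (X (i.1, (σ i).1) : MvPolynomial (Fin n × Fin n) ℕ))
    (fun i => bidegree (i.1, (σ i).1)) fun i _ => isWeightedHomogeneous_X ℕ bidegree (i.1, (σ i).1)
  convert h using 1
  refine Prod.ext ?_ ?_
  · rw [Prod.fst_sum]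
    rfl
  · rw [Prod.snd_sum]
    exact (Equiv.sum_comp σ fun j => (Pi.single j.1 1 : Fin n → ℕ)).symm

theorem isWeightedHomogeneous_adj (i j : Fin n) :
    letI := trivialSymmetry (MvPolynomial (Fin n × Fin n) ℕ)
    IsWeightedHomogeneous bidegree
      (adj (Matrix.mvPolynomialX (Fin n) (Fin n) ℕ) i j)
      (coDegree j, coDegree i) := by
  let := trivialSymmetry (MvPolynomial (Fin n × Fin n) ℕ)
  have h := isWeightedHomogeneous_minor j i
  change IsWeightedHomogeneous bidegree (1 ^ _ * minor _ j i) _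
  rwa [one_pow, one_mul]

theorem isWeightedHomogeneous_det_adj :
    letI := trivialSymmetry (MvPolynomial (Fin n × Fin n) ℕ)
    IsWeightedHomogeneous bidegree
      (det (adj (Matrix.mvPolynomialX (Fin n) (Fin n) ℕ)))
      ((fun _ => n - 1), (fun _ => n - 1)) := by
  let := trivialSymmetry (MvPolynomial (Fin n × Fin n) ℕ)
  refine IsWeightedHomogeneous.sum _ _ _ fun σ _ => ?_
  change IsWeightedHomogeneous bidegree (1 ^ _ * ∏ i, adj _ i (σ i)) _
  rw [one_pow, one_mul]
  have h := IsWeightedHomogeneous.prod Finset.univ _ _ fun i _ => isWeightedHomogeneous_adj i (σ i)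
  convert h using 1
  refine Prod.ext ?_ ?_
  · rw [Prod.fst_sum, Equiv.sum_comp σ coDegree, sum_coDegree]
  · rw [Prod.snd_sum, sum_coDegree]

theorem isWeightedHomogeneous_det_mul_adj :
    letI := trivialSymmetry (MvPolynomial (Fin n × Fin n) ℕ)
    IsWeightedHomogeneous bidegree
      (det (Matrix.mvPolynomialX (Fin n) (Fin n) ℕ * adj (Matrix.mvPolynomialX (Fin n) (Fin n) ℕ)))
      ((fun _ => n), (fun _ => n)) := by
  let := trivialSymmetry (MvPolynomial (Fin n × Fin n) ℕ)
  have hentry : ∀ i j : Fin n, IsWeightedHomogeneous bidegree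
      ((Matrix.mvPolynomialX (Fin n) (Fin n) ℕ * adj (Matrix.mvPolynomialX (Fin n) (Fin n) ℕ)) i j)
      (Pi.single i 1 + coDegree j, 1) := fun i j => by
    rw [Matrix.mul_apply]
    refine IsWeightedHomogeneous.sum _ _ _ fun k _ => ?_
    rw [← single_add_coDegree k]
    exact (isWeightedHomogeneous_X ℕ bidegree (i, k)).mul (isWeightedHomogeneous_adj k j)
  refine IsWeightedHomogeneous.sum _ _ _ fun σ _ => ?_
  change IsWeightedHomogeneous bidegree (1 ^ _ * ∏ i, _) _
  rw [one_pow, one_mul]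
  have h := IsWeightedHomogeneous.prod Finset.univ _ _ fun i _ => hentry i (σ i)
  convert h using 1
  refine Prod.ext ?_ ?_
  · rw [Prod.fst_sum, Finset.sum_add_distrib, Equiv.sum_comp σ coDegree, ← Finset.sum_add_distrib,
      Finset.sum_congr rfl fun i _ => single_add_coDegree i]
    ext
    simp
  · rw [Prod.snd_sum]
    ext
    simp

variable {S M : Type*} [SymmetrySemiring S] [CommSemiring M]

/-- The modulus of a determinant is the permanent of the matrix of moduli. -/
theorem map_det_eq_permanent (hM : IsTotallyOrderedIdempotent M) (μ : S →+* M)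
    (A : Matrix (Fin n) (Fin n) S) :
    μ (det A) = ∑ σ : Equiv.Perm (Fin n), ∏ i, μ (A i (σ i)) := by
  simp [det, sign, map_symm hM]

theorem map_det_adj_natLE (hM : IsTotallyOrderedIdempotent M) (μ : S →+* M)
    (A : Matrix (Fin n) (Fin n) S) : NatLE (μ (det (adj A))) (μ (det A) ^ (n - 1)) := by
  let := trivialSymmetry (MvPolynomial (Fin n × Fin n) ℕ)
  let := trivialSymmetry M
  have h := eval_natLE_permanent hM (A.map μ) isWeightedHomogeneous_det_adj
  have hX : (Matrix.mvPolynomialX (Fin n) (Fin n) ℕ).map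
      (eval₂Hom (Nat.castRingHom M) fun p => A.map μ p.1 p.2) = A.map μ := by
    ext i j
    simp
  rw [map_det_eq_permanent hM μ A, map_det μ (map_symm hM μ), map_adj μ (map_symm hM μ), ← hX,
    ← map_adj _ fun _ => rfl, ← map_det _ fun _ => rfl]
  exact h

theorem map_det_mul_adj_natLE (hM : IsTotallyOrderedIdempotent M) (μ : S →+* M)
    (A : Matrix (Fin n) (Fin n) S) : NatLE (μ (det (A * adj A))) (μ (det A) ^ n) := by
  let := trivialSymmetry (MvPolynomial (Fin n × Fin n) ℕ)
  let := trivialSymmetry M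
  have h := eval_natLE_permanent hM (A.map μ) isWeightedHomogeneous_det_mul_adj
  have hX : (Matrix.mvPolynomialX (Fin n) (Fin n) ℕ).map
      (eval₂Hom (Nat.castRingHom M) fun p => A.map μ p.1 p.2) = A.map μ := by
    ext i j
    simp
  rw [map_det_eq_permanent hM μ A, map_det μ (map_symm hM μ), Matrix.map_mul,
    map_adj μ (map_symm hM μ), ← hX,
    ← map_adj _ fun _ => rfl, ← Matrix.map_mul, ← map_det _ fun _ => rfl]
  exact h

theorem modGE_of_natLE (hM : IsTotallyOrderedIdempotent M) {μ : S →+* M} {a b : S}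
    (h : CircGE a b) (h' : NatLE (μ a) (μ b)) : ModGE μ a b := by
  refine ⟨h, natLE_antisymm hM h' ?_⟩
  obtain ⟨c, -, hc⟩ := h
  exact NatLE.map μ ⟨c, hc⟩

end Adjoint

/-! ### The compound matrix of order `n - 1` -/

section Compound

variable {n : ℕ}

theorem card_erase_univ (i : Fin n) : (Finset.univ.erase i).card = n - 1 := by
  rw [Finset.card_erase_of_mem (Finset.mem_univ i), Finset.card_univ, Fintype.card_fin]

/-- The complement of a point, as an `(n - 1)`-element subset. -/
def complPoint (i : Fin n) : KSubset (Fin n) (n - 1) := ⟨Finset.univ.erase i, card_erase_univ i⟩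

theorem complPoint_bijective (hn : 1 ≤ n) : Function.Bijective (complPoint (n := n)) := by
  constructor
  · intro i j h
    by_contra hne
    have h' : i ∈ (complPoint j).1 := by simp [complPoint, hne]
    rw [← h] at h'
    simp [complPoint] at h'
  · rintro ⟨I, hI⟩
    have hc : Iᶜ.card = 1 := by
      rw [Finset.card_compl, Fintype.card_fin, hI]
      omega
    obtain ⟨i, hi⟩ := Finset.card_eq_one.1 hc
    refine ⟨i, Subtype.ext ?_⟩
    change Finset.univ.erase i = I
    rw [← compl_compl I, hi]
    ext
    simp

theorem sort_erase_univ (i : Fin n) :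
    (Finset.univ.erase i).sort (· ≤ ·) = (List.finRange n).filter (· ≠ i) := by
  refine List.Perm.eq_of_pairwise' (r := (· ≤ ·)) (Finset.pairwise_sort _ _) ?_ ?_
  · exact ((List.pairwise_lt_finRange n).imp le_of_lt).filter _
  · refine (List.perm_ext_iff_of_nodup (Finset.sort_nodup _ _)
      ((List.nodup_finRange n).filter _)).2 fun a => ?_
    simp

/-- The lexicographic order reverses the order of complements: if `i < j`, the sorted complements
of `i` and `j` agree up to position `i`, where they hold respectively a larger element and `i`. -/
theorem complPoint_strictAnti : StrictAnti (complPoint (n := n)) := by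
  intro i j hij
  change (Finset.univ.erase j).sort (· ≤ ·) < (Finset.univ.erase i).sort (· ≤ ·)
  rw [sort_erase_univ, sort_erase_univ]
  obtain ⟨l₁, l₂, hl⟩ := List.append_of_mem (List.mem_finRange i)
  have hp := List.pairwise_lt_finRange n
  have hj : j ∈ List.finRange n := List.mem_finRange j
  rw [hl] at hp hj ⊢
  obtain ⟨-, h2, h3⟩ := List.pairwise_append.1 hp
  obtain ⟨h4, -⟩ := List.pairwise_cons.1 h2
  have hj2 : j ∈ l₂ := by
    rcases List.mem_append.1 hj with h | h
    · exact absurd (h3 j h i (by simp)) hij.asymm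
    · rcases List.mem_cons.1 h with h | h
      · exact absurd h hij.ne'
      · exact h
  have e1 : l₁.filter (· ≠ i) = l₁ := List.filter_eq_self.2 fun a ha => by
    simpa using (h3 a ha i (by simp)).ne
  have e2 : l₁.filter (· ≠ j) = l₁ := List.filter_eq_self.2 fun a ha => by
    simpa using ((h3 a ha i (by simp)).trans hij).ne
  have e3 : l₂.filter (· ≠ i) = l₂ := List.filter_eq_self.2 fun a ha => by
    simpa using (h4 a ha).ne'
  rw [List.filter_append, List.filter_append, e1, e2,
    List.filter_cons_of_pos (by simpa using hij.ne), List.filter_cons_of_neg (by simp), e3]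
  refine List.append_left_lt ?_
  cases l₂ with
  | nil => simp at hj2
  | cons b l => exact List.cons_lt_cons_iff.2 (Or.inl (h4 b (by simp)))

variable {S : Type*} [SymmetrySemiring S]

theorem compound_complPoint (A : Matrix (Fin n) (Fin n) S) (i j : Fin n) :
    compound (n - 1) A (complPoint i) (complPoint j) = minor A i j := by
  let e : ∀ i : Fin n, {x // x ≠ i} ≃o {x // x ∈ (complPoint i).1} := fun i =>
    { Equiv.subtypeEquivRight fun x => by simp [complPoint] with map_rel_iff' := Iff.rfl }
  rw [compound, ← det_submatrix_orderIso (e i) (e j)]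
  rfl

theorem det_adj_eq_det_compound (hn : 1 ≤ n) (A : Matrix (Fin n) (Fin n) S) :
    det (adj A) = det (compound (n - 1) A) := by
  rw [← det_submatrix_antitone (Equiv.ofBijective _ (complPoint_bijective hn))
    complPoint_strictAnti, ← det_transpose, ← det_sign_conj]
  congr 1
  ext i j
  change (-1 : S) ^ ((i : ℕ) + (j : ℕ)) * ((-1) ^ ((j : ℕ) + (i : ℕ)) * minor A i j)
    = compound (n - 1) A (complPoint i) (complPoint j)
  rw [compound_complPoint, ← mul_assoc, add_comm (j : ℕ), ← pow_add, neg_one_pow_add_self, one_mul]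

end Compound

/-! ### Definite matrices -/

section Definite

variable {S : Type*} [SymmetrySemiring S] {n : ℕ}

theorem natLE_minor_diag (A : Matrix (Fin n) (Fin n) S) (h : ∀ i, A i i = 1) (i : Fin n) :
    NatLE 1 (minor A i i) := by
  have h' : NatLE (sign S (Equiv.refl {x // x ≠ i}) * ∏ k : {x // x ≠ i}, A k.1 k.1)
      (minor A i i) :=
    natLE_sum (fun σ : {x // x ≠ i} ≃ {x // x ≠ i} =>
      sign S σ * ∏ k : {x // x ≠ i}, A k.1 (σ k).1) (Equiv.refl _)
  have hinv : inversions (Equiv.refl {x // x ≠ i}) = ∅ := by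
    ext p
    simpa [inversions] using fun h => le_of_lt h
  simpa [sign, hinv, h] using h'

/-- A principal minor of a definite matrix contains the term `1`, and is itself a summand
of `det A = 1`. -/
theorem adj_diag_of_isDefinite (hS : NaturallyOrdered S) {A : Matrix (Fin n) (Fin n) S}
    (hA : IsDefinite A) (i : Fin n) : adj A i i = 1 := by
  have hle : NatLE (adj A i i) 1 := by
    have h := natLE_sum (fun j => A i j * adj A j i) i
    rw [hA.2 i, one_mul] at h
    rwa [← hA.1, ← mul_adj_diag A i, Matrix.mul_apply]
  refine hS _ _ hle ?_
  rw [adj, neg_one_pow_add_self, one_mul]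
  exact natLE_minor_diag A hA.2 i

theorem quasiInverse_eq_adj {A : Matrix (Fin n) (Fin n) S} (hA : det A = 1) :
    quasiInverse A = adj A := by
  ext i j
  rw [quasiInverse, hA, Ring.inverse_one, mul_one]

theorem det_quasiInverse (A : Matrix (Fin n) (Fin n) S) :
    det (quasiInverse A) = Ring.inverse (det A) ^ n * det (adj A) := by
  have h : quasiInverse A = fun i j => Ring.inverse (det A) * adj A i j := by
    ext i j
    exact mul_comm _ _
  rw [h, det_const_mul, Fintype.card_fin]

end Definite

end ExtTrop

theorem proposition4p1 {T M : Type*} [SymmetrySemiring T] [Semifield M] (μ : T →+* M)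
    (hT : IsExtendedTropical μ) {n : ℕ} (hn : 1 ≤ n) (A : Matrix (Fin n) (Fin n) T) :
    (IsDefinite A →
      (∀ i, quasiInverse A i i = 1) ∧
      (∀ i, (A * quasiInverse A) i i = 1) ∧
      ModGE μ (det (A * quasiInverse A)) (det (quasiInverse A)) ∧
      det (quasiInverse A) = det (compound (n - 1) A) ∧
      ModGE μ (det (compound (n - 1) A)) 1) ∧
    (Nonsingular A →
      ModGE μ (det (adj A)) (det A ^ (n - 1)) ∧
      ModGE μ (det (A * adj A)) (det A ^ n) ∧
      ModGE μ (det (quasiInverse A)) (Ring.inverse (det A))) := by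
  have hM := hT.totallyOrdered
  have hS := hT.naturallyOrdered
  have hadj : IsUnit (det A) → ModGE μ (det (adj A)) (det A ^ (n - 1)) := fun hA => by
    obtain ⟨σ, hσ⟩ := exists_det_restrictGraph_eq hM μ hT.rigidity hA
    exact modGE_of_natLE hM (circGE_det_adj hS hσ) (by
      rw [map_pow]; exact map_det_adj_natLE hM μ A)
  have hmul : IsUnit (det A) → ModGE μ (det (A * adj A)) (det A ^ n) := fun hA => by
    obtain ⟨σ, hσ⟩ := exists_det_restrictGraph_eq hM μ hT.rigidity hA
    exact modGE_of_natLE hM (circGE_det_mul_adj hS hσ) (by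
      rw [map_pow]; exact map_det_mul_adj_natLE hM μ A)
  refine ⟨fun hA => ?_, fun hA => ⟨hadj hA, hmul hA, ?_⟩⟩
  · have hu : IsUnit (det A) := by rw [hA.1]; exact isUnit_one
    have h1 := hadj hu
    have h2 := hmul hu
    have h3 := circGE_det_mul A (adj A)
    rw [hA.1, one_pow] at h1 h2
    rw [hA.1, one_mul] at h3
    rw [quasiInverse_eq_adj hA.1, ← det_adj_eq_det_compound hn]
    exact ⟨adj_diag_of_isDefinite hS hA, fun i => by rw [mul_adj_diag, hA.1],
      ⟨h3, h2.2.trans h1.2.symm⟩, rfl, h1⟩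
  · have hinv : Ring.inverse (det A) ^ n * det A ^ (n - 1) = Ring.inverse (det A) := by
      obtain ⟨m, rfl⟩ : ∃ m, n = m + 1 := ⟨n - 1, by omega⟩
      rw [Nat.add_sub_cancel, pow_succ', mul_assoc, ← mul_pow, Ring.inverse_mul_cancel _ hA,
        one_pow, mul_one]
    obtain ⟨h1, h2⟩ := hadj hA
    have h3 := h1.mul_left (Ring.inverse (det A) ^ n)
    rw [hinv, ← det_quasiInverse] at h3
    exact ⟨h3, by rw [det_quasiInverse, map_mul, h2, ← map_mul, hinv]⟩
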